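/- Let $N\ge 1$, fix a norm $|\cdot|$ on $\mathbb{R}^N$, and let $\Omega\subset\mathbb{R}^N$ be open and bounded. For $u\in L^1(\Omega)$ put $$\mathrm{Var}\,u:=\sup\Big\{\int_\Omega u\,\mathrm{div}\,\varphi\,dx \;\Big|\; \varphi\in C^1_c(\Omega;\mathbb{R}^N),\ \sup_x|\varphi(x)|\le 1\Big\}\in[0,\infty],$$ $BV(\Omega):=\{u\in L^1(\Omega)\mid \mathrm{Var}\,u<\infty\}$ and $\|u\|_{BV}:=\|u\|_1+\mathrm{Var}\,u$ (and likewise on $\mathbb{R}^N$). Assume that $\Omega$ is a $BV$ extension domain, i.e. that there is a bounded linear operator $T:BV(\Omega)\to BV(\mathbb{R}^N)$ with $Tu=u$ a.e. on $\Omega$ for all $u\in BV(\Omega)$. For $u\in L^1(\Omega)$ and $\varepsilon>0$ let $$(\varepsilon,\infty)\text{-}\mathrm{Var}\,u:=\inf\{\mathrm{Var}\,v\mid v\in BV(\Omega),\ \|u-v\|_{L^\infty(\Omega)}\le\varepsilon\}\in[0,\infty],\qquad \inf\emptyset=\infty,$$ and let $\mathcal R_\infty(\Omega)$ (the $\infty$-regulated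 functions) be the set of all $u\in L^1(\Omega)$ with $(\varepsilon,\infty)\text{-}\mathrm{Var}\,u<\infty$ for every $\varepsilon>0$. A sequence $(u_n)\subset\mathcal R_\infty(\Omega)$ has uniformly bounded $(\varepsilon,\infty)$-variations if $\sup_n\,(\varepsilon,\infty)\text{-}\mathrm{Var}\,u_n<\infty$ for every $\varepsilon>0$. **Proposition 3.11.** 1. If $(u_n)\subset\mathcal R_\infty(\Omega)$ and $u_n\to u$ in $L^1(\Omega)$, then $$(\varepsilon,\infty)\text{-}\mathrm{Var}\,u\le\liminf_{n}\,(\varepsilon,\infty)\text{-}\mathrm{Var}\,u_n\qquad\text{for each }\varepsilon>0.$$ If moreover $(u_n)$ has uniformly bounded $(\varepsilon,\infty)$-variations, then $u\in\mathcal R_\infty(\Omega)$. 2. Consequently, if $(u_n)\subset\mathcal R_\infty(\Omega)$ is bounded in $L^1(\Omega)$ and has uniformly bounded $(\varepsilon,\infty)$-variations, then there are a subsequence $(u_{n(k)})$ and a function $u\in\mathcal R_\infty(\Omega)$ such that $u_{n(k)}\to u$ in $L^1(\Omega)$ and $(\varepsilon,\infty)\text{-}\mathrm{Var}\,u\le\liminf_{k}\,(\varepsilon,\infty)\text{-}\mathrm{Var}\,u_{n(k)}$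 for each $\varepsilon>0$. -/

import Mathlib

open MeasureTheory Filter Topology
open scoped ENNReal NNReal

noncomputable section

namespace BVReg

/-- `ℝ^N`, with its usual topology and Lebesgue measure. -/
abbrev RN (N : ℕ) : Type := EuclideanSpace ℝ (Fin N)

/-- The space `L¹(Ω)` (with respect to Lebesgue measure) of classes of real functions. -/
abbrev L1 {N : ℕ} (Ω : Set (RN N)) : Type := Lp ℝ 1 (volume.restrict Ω)

/-- The divergence `∑ i, ∂ᵢ φᵢ` of a vector field on `ℝ^N`. -/
def divergence {N : ℕ} (φ : RN N → RN N) (x : RN N) : ℝ :=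
  ∑ i : Fin N, (fderiv ℝ φ x (EuclideanSpace.single i 1)) i

/-- The admissible fields: `φ ∈ [C_c¹(Ω)]^N` with `sup_x ν (φ x) ≤ 1`, where `ν` is the
norm that has been fixed on `ℝ^N`. -/
def testFields {N : ℕ} (ν : Seminorm ℝ (RN N)) (Ω : Set (RN N)) : Set (RN N → RN N) :=
  {φ | ContDiff ℝ 1 φ ∧ HasCompactSupport φ ∧ tsupport φ ⊆ Ω ∧ ∀ x, ν (φ x) ≤ 1}

/-- The variation `Var u = sup {∫_Ω u div φ | φ ∈ [C_c¹(Ω)]^N, ‖φ‖_∞ ≤ 1}`, in `[0, ∞]`.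
(The field `φ = 0` is admissible, so the supremum is nonnegative and the truncation of
negative integrals by `ENNReal.ofReal` does not change it.) -/
def variation {N : ℕ} (ν : Seminorm ℝ (RN N)) {Ω : Set (RN N)} (u : L1 Ω) : ℝ≥0∞ :=
  ⨆ φ ∈ testFields ν Ω, ENNReal.ofReal (∫ x in Ω, u x * divergence φ x)

section helpers

variable {N : ℕ} {ν : Seminorm ℝ (RN N)} {Ω : Set (RN N)}

lemma continuous_divergence {φ : RN N → RN N} (h : ContDiff ℝ 1 φ) :
    Continuous (divergence φ) := by
  have h1 : Continuous (fderiv ℝ φ) := h.continuous_fderiv one_ne_zero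
  unfold divergence
  fun_prop

lemma integrable_mul_divergence {φ : RN N → RN N} (hφ : φ ∈ testFields ν Ω) (u : L1 Ω) :
    Integrable (fun x => u x * divergence φ x) (volume.restrict Ω) := by
  have hc := continuous_divergence hφ.1
  have hs : HasCompactSupport (divergence φ) := by
    refine (hφ.2.1.fderiv (𝕜 := ℝ)).mono' ?_
    refine fun x hx => subset_tsupport _ ?_
    intro h0
    apply hx
    simp [divergence, h0]
  obtain ⟨C, hC⟩ := hc.bounded_above_of_compact_support hs
  exact (L1.integrable_coeFn u).mul_bdd hc.aestronglyMeasurable (ae_of_all _ hC)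

lemma le_variation {φ : RN N → RN N} (hφ : φ ∈ testFields ν Ω) (u : L1 Ω) :
    ENNReal.ofReal (∫ x in Ω, u x * divergence φ x) ≤ variation ν u :=
  le_iSup₂ (f := fun φ (_ : φ ∈ testFields ν Ω) =>
    ENNReal.ofReal (∫ x in Ω, u x * divergence φ x)) φ hφ

lemma neg_mem_testFields {φ : RN N → RN N} (hφ : φ ∈ testFields ν Ω) :
    -φ ∈ testFields ν Ω := by
  obtain ⟨h1, h2, h3, h4⟩ := hφ
  refine ⟨h1.neg, h2.neg, ?_, fun x => ?_⟩
  · rwa [tsupport_neg]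
  · simpa using h4 x

lemma divergence_neg (φ : RN N → RN N) (x : RN N) :
    divergence (-φ) x = -divergence φ x := by
  simp [divergence, fderiv_neg]

lemma variation_zero : variation ν (0 : L1 Ω) = 0 := by
  refine le_antisymm (iSup₂_le fun φ _ => ?_) zero_le
  have : ∫ x in Ω, (0 : L1 Ω) x * divergence φ x = 0 := by
    rw [← integral_zero (RN N) ℝ (μ := volume.restrict Ω)]
    refine integral_congr_ae ?_
    filter_upwards [Lp.coeFn_zero ℝ 1 (volume.restrict Ω)] with x hx
    rw [hx, Pi.zero_apply, zero_mul]
  rw [this, ENNReal.ofReal_zero]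

lemma variation_add_le (u v : L1 Ω) :
    variation ν (u + v) ≤ variation ν u + variation ν v := by
  refine iSup₂_le fun φ hφ => ?_
  have : ∫ x in Ω, (u + v : L1 Ω) x * divergence φ x
      = (∫ x in Ω, u x * divergence φ x) + ∫ x in Ω, v x * divergence φ x := by
    rw [← integral_add (integrable_mul_divergence hφ u) (integrable_mul_divergence hφ v)]
    refine integral_congr_ae ?_
    filter_upwards [Lp.coeFn_add u v] with x hx
    rw [hx, Pi.add_apply, add_mul]
  rw [this]
  exact ENNReal.ofReal_add_le.trans (add_le_add (le_variation hφ u) (le_variation hφ v))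

lemma variation_smul_le (c : ℝ) (u : L1 Ω) :
    variation ν (c • u) ≤ ENNReal.ofReal |c| * variation ν u := by
  refine iSup₂_le fun φ hφ => ?_
  have key : ∫ x in Ω, (c • u : L1 Ω) x * divergence φ x
      = c * ∫ x in Ω, u x * divergence φ x := by
    rw [← integral_const_mul]
    refine integral_congr_ae ?_
    filter_upwards [Lp.coeFn_smul c u] with x hx
    rw [hx, Pi.smul_apply, smul_eq_mul, mul_assoc]
  rw [key]
  rcases le_total 0 c with hc | hc
  · rw [abs_of_nonneg hc, ENNReal.ofReal_mul hc]
    gcongr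
    exact le_variation hφ u
  · have h2 := le_variation (neg_mem_testFields hφ) u
    simp only [divergence_neg, mul_neg, integral_neg] at h2
    rw [abs_of_nonpos hc, ← neg_mul_neg, ENNReal.ofReal_mul (neg_nonneg.2 hc)]
    gcongr

end helpers

/-- The space `BV(Ω)` of functions `u ∈ L¹(Ω)` with `Var u < ∞`. -/
def BV {N : ℕ} (ν : Seminorm ℝ (RN N)) (Ω : Set (RN N)) : Submodule ℝ (L1 Ω) where
  carrier := {u | variation ν u < ∞}
  zero_mem' := by simp [variation_zero]
  add_mem' := fun {u v} hu hv =>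
    (variation_add_le u v).trans_lt (ENNReal.add_lt_top.2 ⟨hu, hv⟩)
  smul_mem' := fun c u hu =>
    (variation_smul_le c u).trans_lt (ENNReal.mul_lt_top ENNReal.ofReal_lt_top hu)

/-- The norm `‖u‖_BV = ‖u‖₁ + Var u` (as an extended nonnegative number, finite on `BV(Ω)`). -/
def bvNorm {N : ℕ} (ν : Seminorm ℝ (RN N)) {Ω : Set (RN N)} (u : L1 Ω) : ℝ≥0∞ :=
  ‖u‖ₑ + variation ν u

/-- `Ω` is a `BV` extension domain: there is a linear and continuous (that is, bounded)
operator `T : BV(Ω) → BV(ℝ^N)` with `T u = u` a.e. on `Ω`. Nothing further is asked of `T`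
(such as support near `Ω`, no variation of `T u` charged to the boundary, or
boundedness between Sobolev spaces), so every domain for which `T` can be chosen with such
additional properties is included. -/
def IsBVExtensionDomain {N : ℕ} (ν : Seminorm ℝ (RN N)) (Ω : Set (RN N)) : Prop :=
  ∃ T : BV ν Ω →ₗ[ℝ] BV ν (Set.univ : Set (RN N)),
    (∃ C : ℝ≥0, ∀ u : BV ν Ω, bvNorm ν (T u).1 ≤ C * bvNorm ν u.1) ∧
    ∀ u : BV ν Ω, ∀ᵐ x ∂(volume.restrict Ω), (T u).1 x = u.1 x

/-- The set `𝒱_p(u; ε) = {v ∈ BV(Ω) | ‖u - v‖_p ≤ ε}`. -/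
def approximants {N : ℕ} (ν : Seminorm ℝ (RN N)) {Ω : Set (RN N)} (p : ℝ≥0∞) (ε : ℝ)
    (u : L1 Ω) : Set (L1 Ω) :=
  {v | v ∈ BV ν Ω ∧
    eLpNorm (fun x => u x - v x) p (volume.restrict Ω) ≤ ENNReal.ofReal ε}

/-- The `(ε, p)`-variation of `u ∈ L¹(Ω)`, i.e. `inf {Var v | v ∈ 𝒱_p(u; ε)}`, which is `∞`
if there is no such `v`. -/
def epsVariation {N : ℕ} (ν : Seminorm ℝ (RN N)) {Ω : Set (RN N)} (p : ℝ≥0∞) (ε : ℝ)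
    (u : L1 Ω) : ℝ≥0∞ :=
  ⨅ v ∈ approximants ν p ε u, variation ν v

/-- The set `ℛ_p(Ω)` of `p`-regulated functions. -/
def regulated {N : ℕ} (ν : Seminorm ℝ (RN N)) (p : ℝ≥0∞) (Ω : Set (RN N)) : Set (L1 Ω) :=
  {u | ∀ ε : ℝ, 0 < ε → epsVariation ν p ε u < ∞}

/-- A set of `p`-regulated functions has uniformly bounded `(ε, p)`-variations. -/
def UniformlyBoundedEpsVariations {N : ℕ} (ν : Seminorm ℝ (RN N)) (p : ℝ≥0∞)
    {Ω : Set (RN N)} (F : Set (L1 Ω)) : Prop :=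
  F ⊆ regulated ν p Ω ∧ ∀ ε : ℝ, 0 < ε → (⨆ u ∈ F, epsVariation ν p ε u) < ∞

end BVReg

end

noncomputable section
namespace BVReg

/-! Both claims rest on compactness: a BV-bounded set is totally bounded in `L¹(Ω)`
(`totallyBounded_bvNorm_le`). After extension to `ℝ^N`, bounded variation controls translations:
`‖f(· + h) - f‖₁` is at most `ν h` times the variation (`integral_abs_translate_sub_le`). Hence `f`
is uniformly `L¹`-close on `Ω` to its averages over small balls with centres in a finite net, and
these averages form a bounded set in a finite-dimensional space.

For semicontinuity, near-minimisers `v n` for `u n` are BV-bounded along a subsequence realising the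
liminf, so a further subsequence converges in `L¹`. Its limit competes for `u₀`, because the
variation is lower semicontinuous and the constraint `‖u - v‖_∞ ≤ ε` is closed in `L¹`. For
compactness, `Ω` has finite measure, so the `u n` lie `L¹`-close to a BV-bounded set at every scale
and are themselves totally bounded. -/

variable {N : ℕ}

/-! ### Translation estimate for functions of bounded variation on `ℝ^N` -/

lemma divergence_translate_smul {g : RN N → ℝ} (hg : ContDiff ℝ 1 g) (a w x : RN N) :
    divergence (fun y => g (y - a) • w) x = fderiv ℝ g (x - a) w := by
  have hd : HasFDerivAt (fun y => g (y - a)) (fderiv ℝ g (x - a)) x :=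
    ((hg.differentiable one_ne_zero) (x - a)).hasFDerivAt.comp x (hasFDerivAt_sub_const a)
  have hd' := hd.smul_const w
  unfold divergence
  rw [hd'.fderiv]
  conv_rhs => rw [← (EuclideanSpace.basisFun (Fin N) ℝ).sum_repr w, map_sum]
  refine Finset.sum_congr rfl fun i _ => ?_
  simp [mul_comm]

lemma translate_smul_mem_testFields {ν : Seminorm ℝ (RN N)} {g : RN N → ℝ}
    (hg : ContDiff ℝ 1 g) (hgs : HasCompactSupport g) (hg1 : ∀ x, |g x| ≤ 1)
    (a : RN N) {w : RN N} (hw : ν w ≤ 1) :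
    (fun y => g (y - a) • w) ∈ testFields ν Set.univ := by
  refine ⟨?_, ?_, Set.subset_univ _, fun x => ?_⟩
  · fun_prop
  · have h1 : HasCompactSupport (fun y => g (y - a)) := by
      simpa [sub_eq_add_neg, Function.comp_def] using
        hgs.comp_homeomorph (Homeomorph.addRight (-a))
    exact h1.smul_right
  · rw [map_smul_eq_mul, Real.norm_eq_abs]
    exact mul_le_one₀ (hg1 _) (apply_nonneg _ _) hw

/-- The fields `g(· - a) w` with `w = ±A⁻¹ h` are admissible. Scaling by a positive `A ≥ ν h`
instead of `ν h` avoids dividing by zero. -/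
lemma abs_integral_mul_fderiv_le {ν : Seminorm ℝ (RN N)} {f : RN N → ℝ} {V A : ℝ}
    (hV : ∀ φ ∈ testFields ν Set.univ, ∫ x, f x * divergence φ x ≤ V)
    {g : RN N → ℝ} (hg : ContDiff ℝ 1 g) (hgs : HasCompactSupport g) (hg1 : ∀ x, |g x| ≤ 1)
    (a : RN N) {h : RN N} (hA : 0 < A) (hh : ν h ≤ A) :
    |∫ x, f x * fderiv ℝ g (x - a) h| ≤ A * V := by
  have key : ∀ w : RN N, ν w ≤ 1 → ∫ x, f x * fderiv ℝ g (x - a) w ≤ V := fun w hw => by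
    have := hV _ (translate_smul_mem_testFields hg hgs hg1 a hw)
    simpa only [divergence_translate_smul hg] using this
  have hw : ν (A⁻¹ • h) ≤ 1 := by
    rw [map_smul_eq_mul, Real.norm_eq_abs, abs_of_pos (inv_pos.2 hA)]
    exact (inv_mul_le_one₀ hA).2 hh
  have h1 := key _ hw
  have h2 := key (-(A⁻¹ • h)) (by rwa [map_neg_eq_map])
  simp only [map_neg, map_smul, smul_eq_mul, mul_neg, integral_neg, mul_left_comm _ A⁻¹,
    integral_const_mul] at h1 h2
  rw [← div_eq_inv_mul, div_le_iff₀' hA] at h1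
  rw [← div_eq_inv_mul, ← neg_div, div_le_iff₀' hA] at h2
  exact abs_le.2 ⟨by linarith, h1⟩

/-- Mean value inequality on `[0, 1]` for `t ↦ ∫ f(x) g(x - t h)`: only the test function is
differentiated, so `f` needs no regularity. -/
lemma abs_integral_mul_translate_sub_le {ν : Seminorm ℝ (RN N)} {f : RN N → ℝ} {V A : ℝ}
    (hf : Integrable f)
    (hV : ∀ φ ∈ testFields ν Set.univ, ∫ x, f x * divergence φ x ≤ V)
    {g : RN N → ℝ} (hg : ContDiff ℝ 1 g) (hgs : HasCompactSupport g) (hg1 : ∀ x, |g x| ≤ 1)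
    {h : RN N} (hA : 0 < A) (hh : ν h ≤ A) :
    |(∫ x, f x * g (x - h)) - ∫ x, f x * g x| ≤ A * V := by
  have hc : Continuous (fderiv ℝ g) := hg.continuous_fderiv one_ne_zero
  obtain ⟨C, hC⟩ := hc.bounded_above_of_compact_support (hgs.fderiv (𝕜 := ℝ))
  have hgc := hg.continuous
  have hderiv : ∀ t : ℝ, HasDerivAt (fun t : ℝ => ∫ x, f x * g (x - t • h))
      (∫ x, f x * -(fderiv ℝ g (x - t • h) h)) t := by
    intro t
    refine (hasDerivAt_integral_of_dominated_loc_of_deriv_le (s := Set.univ)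
      (F := fun (t : ℝ) x => f x * g (x - t • h))
      (F' := fun (t : ℝ) x => f x * -(fderiv ℝ g (x - t • h) h))
      (bound := fun x => |f x| * (C * ‖h‖)) univ_mem ?_ ?_ ?_ ?_ ?_ ?_).2
    · refine Eventually.of_forall fun t => hf.aestronglyMeasurable.mul ?_
      exact (by fun_prop : Continuous fun x => g (x - t • h)).aestronglyMeasurable
    · refine hf.mul_bdd (c := 1) ?_ (ae_of_all _ fun x => hg1 _)
      exact (by fun_prop : Continuous fun x => g (x - t • h)).aestronglyMeasurable
    · refine hf.aestronglyMeasurable.mul ?_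
      exact (by fun_prop :
        Continuous fun x => -(fderiv ℝ g (x - t • h) h)).aestronglyMeasurable
    · refine ae_of_all _ fun x t _ => ?_
      rw [norm_mul, norm_neg, Real.norm_eq_abs]
      gcongr
      exact (ContinuousLinearMap.le_opNorm _ _).trans (by gcongr; exact hC _)
    · exact hf.abs.mul_const _
    · refine ae_of_all _ fun x t _ => ?_
      have h1 : HasDerivAt (fun t : ℝ => x - t • h) (-h) t := by
        simpa using ((hasDerivAt_id t).smul_const h).const_sub x
      have h2 := (((hg.differentiable one_ne_zero) (x - t • h)).hasFDerivAt.comp_hasDerivAt t h1)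
      rw [map_neg] at h2
      exact h2.const_mul (f x)
  have := norm_image_sub_le_of_norm_deriv_le_segment_01' (C := A * V)
    (fun t _ => (hderiv t).hasDerivWithinAt) (fun t _ => ?_)
  · simpa using this
  · simp only [mul_neg, integral_neg, norm_neg, Real.norm_eq_abs]
    exact abs_integral_mul_fderiv_le hV hg hgs hg1 _ hA hh

lemma abs_sub_le_mul_div_sqrt (a : ℝ) {κ : ℝ} (hκ : 0 < κ) :
    |a| - κ ≤ a * (a / √(a ^ 2 + κ ^ 2)) := by
  have hs : 0 < √(a ^ 2 + κ ^ 2) := Real.sqrt_pos.2 (by positivity)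
  have h2 : √(a ^ 2 + κ ^ 2) ^ 2 = a ^ 2 + κ ^ 2 := Real.sq_sqrt (by positivity)
  have h1 : √(a ^ 2 + κ ^ 2) ≤ |a| + κ := by
    refine Real.sqrt_le_iff.2 ⟨by positivity, ?_⟩
    nlinarith [abs_nonneg a, sq_abs a]
  rw [← mul_div_assoc, le_div_iff₀ hs]
  rcases le_total (|a| - κ) 0 with h | h
  · nlinarith [mul_self_nonneg a]
  · nlinarith [sq_abs a, mul_le_mul_of_nonneg_left h1 h]

/-- The ideal test function is the sign of `F`. It is replaced by the `C¹` function `G / √(G² +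
κ²)`, with `G` a smooth compactly supported `L¹`-approximation of `F`. -/
lemma integral_abs_le_of_forall_contDiff {F : RN N → ℝ} (hF : Integrable F) {K : ℝ}
    (hK : ∀ g : RN N → ℝ, ContDiff ℝ 1 g → HasCompactSupport g → (∀ x, |g x| ≤ 1) →
      ∫ x, F x * g x ≤ K) :
    ∫ x, |F x| ≤ K := by
  refine le_of_forall_pos_le_add fun η hη => ?_
  obtain ⟨G, hGs, hGc, hFG⟩ := MemLp.exist_eLpNorm_sub_le (p := 1) (μ := (volume : Measure (RN N)))
    ENNReal.one_ne_top le_rfl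
    (memLp_one_iff_integrable.2 hF) (ε := η / 4) (by positivity)
  have hGc1 : ContDiff ℝ 1 G := hGc.of_le (by exact_mod_cast le_top)
  have hGi : Integrable G := hGc1.continuous.integrable_of_hasCompactSupport hGs
  have hFGi : Integrable fun x => |F x - G x| := (hF.sub hGi).abs
  have hFG' : ∫ x, |F x - G x| ≤ η / 4 := by
    have := integral_norm_eq_lintegral_enorm (hF.sub hGi).aestronglyMeasurable
    simp only [Real.norm_eq_abs, Pi.sub_apply] at this
    rw [this]
    rw [eLpNorm_one_eq_lintegral_enorm] at hFG
    exact ENNReal.toReal_le_of_le_ofReal (by positivity) hFG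
  set S : ℝ := volume.real (tsupport G)
  have hS : 0 ≤ S := measureReal_nonneg
  -- Smoothing the sign costs at most `κ` at each point of the support of `G`, so at most `η / 4` in
  -- all; replacing `F` by `G` costs `η / 4` twice more.
  set κ : ℝ := η / (4 * (S + 1))
  have hκ : 0 < κ := by positivity
  have hκS : κ * S ≤ η / 4 := by
    have : κ * (S + 1) = η / 4 := by simp only [κ]; field_simp
    nlinarith
  set g : RN N → ℝ := fun x => G x / √(G x ^ 2 + κ ^ 2)
  have hpos : ∀ x, 0 < G x ^ 2 + κ ^ 2 := fun x => by positivity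
  have hgc : ContDiff ℝ 1 g :=
    hGc1.div (((hGc1.pow 2).add contDiff_const).sqrt fun x => (hpos x).ne')
      fun x => (Real.sqrt_pos.2 (hpos x)).ne'
  have hgs : HasCompactSupport g := by
    refine hGs.mono fun x hx h0 => hx ?_
    simp only [g, h0, zero_div]
  have hg1 : ∀ x, |g x| ≤ 1 := fun x => by
    rw [abs_div, abs_of_pos (Real.sqrt_pos.2 (hpos x)), div_le_one (Real.sqrt_pos.2 (hpos x))]
    exact Real.abs_le_sqrt (by nlinarith)
  have hbd : ∀ {H : RN N → ℝ}, Integrable H → Integrable fun x => H x * g x := fun hH =>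
    hH.mul_bdd (c := 1) hgc.continuous.aestronglyMeasurable (ae_of_all _ hg1)
  have h1 : ∫ x, |G x| ≤ (∫ x, G x * g x) + κ * S := by
    have hind : Integrable (Set.indicator (tsupport G) fun _ => κ) := by
      refine (integrable_indicator_iff (isClosed_tsupport G).measurableSet).2 ?_
      exact integrableOn_const hGs.isCompact.measure_lt_top.ne
    have : ∫ x, Set.indicator (tsupport G) (fun _ => κ) x = κ * S := by
      rw [integral_indicator_const _ (isClosed_tsupport G).measurableSet, smul_eq_mul, mul_comm]
    rw [← this, ← integral_add (hbd hGi) hind]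
    refine integral_mono hGi.abs ((hbd hGi).add hind) fun x => ?_
    by_cases hx : x ∈ tsupport G
    · simpa [hx] using by linarith [abs_sub_le_mul_div_sqrt (G x) hκ]
    · simp [hx, image_eq_zero_of_notMem_tsupport hx]
  have h2 : ∫ x, G x * g x ≤ (∫ x, F x * g x) + η / 4 := by
    refine le_trans ?_ (add_le_add_right hFG' _)
    rw [← integral_add (hbd hF) hFGi]
    refine integral_mono (hbd hGi) ((hbd hF).add hFGi) fun x => ?_
    have : |(F x - G x) * g x| ≤ |F x - G x| := by
      rw [abs_mul]; exact mul_le_of_le_one_right (abs_nonneg _) (hg1 x)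
    linarith [neg_le_of_abs_le this]
  have h3 : ∫ x, |F x| ≤ (∫ x, |G x|) + η / 4 := by
    refine le_trans ?_ (add_le_add_right hFG' _)
    rw [← integral_add hGi.abs hFGi]
    refine integral_mono hF.abs (hGi.abs.add hFGi) fun x => ?_
    linarith [abs_sub_abs_le_abs_sub (F x) (G x)]
  linarith [hK g hgc hgs hg1]

/-- By duality it suffices to test against `g`; the substitution `x ↦ x + h` moves the translation
from `f` to `g`. -/
lemma integral_abs_translate_sub_le {ν : Seminorm ℝ (RN N)} {f : RN N → ℝ} {V A : ℝ}
    (hf : Integrable f)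
    (hV : ∀ φ ∈ testFields ν Set.univ, ∫ x, f x * divergence φ x ≤ V)
    {h : RN N} (hA : 0 < A) (hh : ν h ≤ A) :
    ∫ x, |f (x + h) - f x| ≤ A * V := by
  have hfh := hf.comp_add_right h
  refine integral_abs_le_of_forall_contDiff (hfh.sub hf) fun g hg hgs hg1 => ?_
  have hbd : ∀ {H : RN N → ℝ}, Integrable H → Integrable fun x => H x * g x := fun hH =>
    hH.mul_bdd (c := 1) hg.continuous.aestronglyMeasurable (ae_of_all _ hg1)
  refine le_trans (le_of_eq ?_)
    (le_of_abs_le (abs_integral_mul_translate_sub_le hf hV hg hgs hg1 hA hh))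
  rw [← integral_add_right_eq_self (fun x => f x * g (x - h)) h]
  simp only [sub_mul, add_sub_cancel_right, Pi.sub_apply]
  exact integral_sub (hbd hfh) (hbd hf)

/-! ### Approximation by averages over balls -/

lemma enorm_sub_average_le {X : Type*} [MeasurableSpace X] {μ : Measure X} {s : Set X}
    (hs0 : μ s ≠ 0) (hs : μ s ≠ ∞) {f : X → ℝ} (hf : IntegrableOn f s μ) (a : ℝ) :
    ‖a - ⨍ y in s, f y ∂μ‖ₑ ≤ (μ s)⁻¹ * ∫⁻ y in s, ‖a - f y‖ₑ ∂μ := by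
  have : IsFiniteMeasure (μ.restrict s) := ⟨by simpa using hs.lt_top⟩
  have : NeZero (μ.restrict s) := ⟨by simpa using hs0⟩
  have h1 : a - ⨍ y in s, f y ∂μ = ⨍ y in s, (a - f y) ∂μ := by
    have ha : ⨍ _ in s, a ∂μ = a := average_const _ _
    conv_lhs => rw [← ha]
    simp only [average_eq, ← smul_sub]
    rw [integral_sub (integrable_const a) hf]
  rw [h1, average]
  refine (enorm_integral_le_lintegral_enorm _).trans (le_of_eq ?_)
  rw [lintegral_smul_measure, Measure.restrict_apply_univ, smul_eq_mul]

/-- The ball of radius `δ` about `π x` lies in the ball of radius `2δ` about `x`, so Tonelli reduces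
the error to translations by `‖h‖ < 2δ`. The factor `2 ^ N` is the ratio of the two volumes. -/
lemma lintegral_sub_average_ball_le {f : RN N → ℝ} (hfm : Measurable f) (hf : Integrable f)
    {Ω : Set (RN N)} (hΩ : MeasurableSet Ω) {δ η : ℝ} (hδ : 0 < δ)
    (hη : ∀ h : RN N, ‖h‖ < 2 * δ → ∫ x, |f (x + h) - f x| ≤ η)
    {π : RN N → RN N} (hπ : ∀ x ∈ Ω, dist (π x) x < δ) :
    ∫⁻ x in Ω, ‖f x - ⨍ y in Metric.ball (π x) δ, f y‖ₑ ≤ 2 ^ N * ENNReal.ofReal η := by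
  set c : ℝ≥0∞ := volume (Metric.ball (0 : RN N) δ)
  have hc0 : c ≠ 0 := (Metric.measure_ball_pos _ _ hδ).ne'
  have hc : c ≠ ∞ := measure_ball_lt_top.ne
  have hpt : ∀ x ∈ Ω, ‖f x - ⨍ y in Metric.ball (π x) δ, f y‖ₑ ≤
      c⁻¹ * ∫⁻ h in Metric.ball (0 : RN N) (2 * δ), ‖f (x + h) - f x‖ₑ := by
    intro x hx
    have hv : volume (Metric.ball (π x) δ) = c := Measure.addHaar_ball_center _ _ _
    refine (enorm_sub_average_le (by rwa [hv]) (by rwa [hv]) hf.integrableOn _).trans ?_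
    rw [hv]
    gcongr c⁻¹ * ?_
    have hsub : Metric.ball (π x) δ ⊆ Metric.ball x (2 * δ) :=
      Metric.ball_subset_ball' (by linarith [hπ x hx])
    refine (lintegral_mono_set hsub).trans (le_of_eq ?_)
    rw [← lintegral_indicator Metric.isOpen_ball.measurableSet,
      ← lintegral_indicator Metric.isOpen_ball.measurableSet,
      ← lintegral_add_left_eq_self _ x]
    refine lintegral_congr fun h => ?_
    have : x + h ∈ Metric.ball x (2 * δ) ↔ h ∈ Metric.ball (0 : RN N) (2 * δ) := by
      simp [Metric.mem_ball, dist_eq_norm]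
    by_cases hh : h ∈ Metric.ball (0 : RN N) (2 * δ)
    · rw [Set.indicator_of_mem (this.2 hh), Set.indicator_of_mem hh, ← enorm_neg, neg_sub]
    · rw [Set.indicator_of_notMem (mt this.1 hh), Set.indicator_of_notMem hh]
  have hmeas : Measurable fun p : RN N × RN N => ‖f (p.1 + p.2) - f p.1‖ₑ :=
    ((hfm.comp (measurable_fst.add measurable_snd)).sub (hfm.comp measurable_fst)).enorm
  calc ∫⁻ x in Ω, ‖f x - ⨍ y in Metric.ball (π x) δ, f y‖ₑ
      ≤ ∫⁻ x in Ω, c⁻¹ * ∫⁻ h in Metric.ball (0 : RN N) (2 * δ), ‖f (x + h) - f x‖ₑ :=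
        setLIntegral_mono' hΩ hpt
    _ ≤ ∫⁻ x, c⁻¹ * ∫⁻ h in Metric.ball (0 : RN N) (2 * δ), ‖f (x + h) - f x‖ₑ :=
        setLIntegral_le_lintegral _ _
    _ = c⁻¹ * ∫⁻ h in Metric.ball (0 : RN N) (2 * δ), ∫⁻ x, ‖f (x + h) - f x‖ₑ := by
        rw [lintegral_const_mul' _ _ (ENNReal.inv_ne_top.2 hc0),
          lintegral_lintegral_swap hmeas.aemeasurable]
    _ ≤ c⁻¹ * ∫⁻ _ in Metric.ball (0 : RN N) (2 * δ), ENNReal.ofReal η := by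
        gcongr 1
        refine setLIntegral_mono' Metric.isOpen_ball.measurableSet fun h hh => ?_
        have hi : Integrable fun x => f (x + h) - f x := (hf.comp_add_right h).sub hf
        rw [← ofReal_integral_norm_eq_lintegral_enorm hi]
        exact ENNReal.ofReal_le_ofReal (hη h (by simpa using hh))
    _ = 2 ^ N * ENNReal.ofReal η := by
        rw [setLIntegral_const, Measure.addHaar_ball_mul_of_pos _ _ two_pos, finrank_euclideanSpace_fin]
        have h2 : ENNReal.ofReal ((2 : ℝ) ^ N) = 2 ^ N := by
          rw [ENNReal.ofReal_pow zero_le_two]; simp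
        rw [h2]
        change c⁻¹ * (_ * (2 ^ N * c)) = _
        rw [show c⁻¹ * (ENNReal.ofReal η * (2 ^ N * c)) = (c⁻¹ * c) * (2 ^ N * ENNReal.ofReal η)
          by ring, ENNReal.inv_mul_cancel hc0 hc, one_mul]

/-! ### Total boundedness of BV-bounded sets in `L¹(Ω)` -/

lemma totallyBounded_of_approx {X : Type*} [PseudoMetricSpace X] {S : Set X}
    (h : ∀ ε > 0, ∃ T : Set X, TotallyBounded T ∧ ∀ v ∈ S, ∃ w ∈ T, dist v w < ε) :
    TotallyBounded S := by
  refine Metric.totallyBounded_iff.2 fun ε hε => ?_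
  obtain ⟨T, hT, hST⟩ := h (ε / 2) (half_pos hε)
  obtain ⟨t, ht, hTt⟩ := Metric.totallyBounded_iff.1 hT (ε / 2) (half_pos hε)
  refine ⟨t, ht, fun v hv => ?_⟩
  obtain ⟨w, hw, hvw⟩ := hST v hv
  obtain ⟨y, hy, hwy⟩ := Set.mem_iUnion₂.1 (hTt hw)
  refine Set.mem_iUnion₂.2 ⟨y, hy, ?_⟩
  have := dist_triangle v w y
  rw [Metric.mem_ball] at hwy ⊢
  linarith

lemma exists_simpleFunc_dist_lt {Ω : Set (RN N)} (hΩ : Bornology.IsBounded Ω) {δ : ℝ}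
    (hδ : 0 < δ) : ∃ π : SimpleFunc (RN N) (RN N), ∀ x ∈ Ω, dist (π x) x < δ := by
  set e := TopologicalSpace.denseSeq (RN N)
  obtain ⟨t, ht⟩ := hΩ.isCompact_closure.elim_finite_subcover
    (fun k => Metric.ball (e k) δ) (fun _ => Metric.isOpen_ball) fun x _ => by
      obtain ⟨k, hk⟩ := (TopologicalSpace.denseRange_denseSeq (RN N)).exists_dist_lt x hδ
      exact Set.mem_iUnion.2 ⟨k, hk⟩
  refine ⟨SimpleFunc.nearestPt e (t.sup id), fun x hx => ?_⟩
  obtain ⟨k, hk, hxk⟩ := Set.mem_iUnion₂.1 (ht (subset_closure hx))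
  have h1 := SimpleFunc.edist_nearestPt_le e x (Finset.le_sup (f := id) hk)
  rw [edist_dist, edist_dist, id, ENNReal.ofReal_le_ofReal_iff dist_nonneg, dist_comm (e k)] at h1
  exact h1.trans_lt hxk

lemma exists_seminorm_le_mul_norm (ν : Seminorm ℝ (RN N)) :
    ∃ C : ℝ, 0 < C ∧ ∀ h, ν h ≤ C * ‖h‖ := by
  refine ⟨∑ i, ν (EuclideanSpace.single i 1) + 1,
    add_pos_of_nonneg_of_pos (Finset.sum_nonneg fun i _ => apply_nonneg _ _) one_pos, fun h => ?_⟩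
  conv_lhs => rw [← (EuclideanSpace.basisFun (Fin N) ℝ).sum_repr h]
  refine (Finset.le_sum_of_subadditive ν (map_zero ν).le (map_add_le_add ν) _ _).trans ?_
  rw [add_mul, Finset.sum_mul]
  refine le_add_of_le_of_nonneg (Finset.sum_le_sum fun i _ => ?_) (by positivity)
  rw [map_smul_eq_mul, mul_comm]
  simpa using mul_le_mul_of_nonneg_left (PiLp.norm_apply_le h i) (apply_nonneg ν _)

lemma memLp_comp_simpleFunc {Ω : Set (RN N)} [IsFiniteMeasure (volume.restrict Ω)]
    (π : SimpleFunc (RN N) (RN N)) (a : π.range → ℝ) :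
    MemLp (fun x => a ⟨π x, π.mem_range_self x⟩) 1 (volume.restrict Ω) :=
  MemLp.of_bound ((Measurable.of_discrete (f := a)).comp
    (π.measurable.subtype_mk)).aestronglyMeasurable ‖a‖ (ae_of_all _ fun _ => norm_le_pi_norm a _)

/-- Precomposition with a simple function, as a linear map on functions on its finite range. -/
def simpleFuncComp {Ω : Set (RN N)} [IsFiniteMeasure (volume.restrict Ω)]
    (π : SimpleFunc (RN N) (RN N)) : (π.range → ℝ) →ₗ[ℝ] L1 Ω where
  toFun a := (memLp_comp_simpleFunc π a).toLp
  map_add' _ _ := rfl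
  map_smul' _ _ := rfl

lemma coeFn_simpleFuncComp {Ω : Set (RN N)} [IsFiniteMeasure (volume.restrict Ω)]
    (π : SimpleFunc (RN N) (RN N)) (b : RN N → ℝ) :
    simpleFuncComp (Ω := Ω) π (fun p => b p) =ᵐ[volume.restrict Ω] fun x => b (π x) :=
  (memLp_comp_simpleFunc π fun p => b p).coeFn_toLp

lemma totallyBounded_of_extension {ν : Seminorm ℝ (RN N)} {Ω : Set (RN N)}
    (hΩ : MeasurableSet Ω) (hb : Bornology.IsBounded Ω) {S : Set (L1 Ω)} {M : ℝ} (hM : 0 < M)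
    (hS : ∀ v ∈ S, ∃ f : RN N → ℝ, Measurable f ∧ Integrable f ∧
      (f =ᵐ[volume.restrict Ω] v) ∧ ∫ x, |f x| ≤ M ∧
      ∀ φ ∈ testFields ν Set.univ, ∫ x, f x * divergence φ x ≤ M) :
    TotallyBounded S := by
  have : IsFiniteMeasure (volume.restrict Ω) := ⟨by simpa using hb.measure_lt_top⟩
  obtain ⟨C, hC, hνC⟩ := exists_seminorm_le_mul_norm ν
  refine totallyBounded_of_approx fun ε hε => ?_
  -- Chosen so that the averaging error `2 ^ N * (C * (2 * δ) * M)` equals `ε / 2`.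
  set δ : ℝ := ε / (2 ^ N * (C * 2 * M) * 2)
  have hδ : 0 < δ := by positivity
  obtain ⟨π, hπ⟩ := exists_simpleFunc_dist_lt hb hδ
  set c : ℝ := volume.real (Metric.ball (0 : RN N) δ)
  have hc : 0 < c := ENNReal.toReal_pos (Metric.measure_ball_pos _ _ hδ).ne' measure_ball_lt_top.ne
  -- Each average is at most `M` divided by the volume of the ball, so the approximants lie in the
  -- linear image of a compact cube.
  refine ⟨simpleFuncComp π '' Set.pi Set.univ fun _ => Set.Icc (-(c⁻¹ * M)) (c⁻¹ * M),
    ((isCompact_univ_pi fun _ => isCompact_Icc).image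
      (simpleFuncComp π).continuous_of_finiteDimensional).totallyBounded, fun v hv => ?_⟩
  obtain ⟨f, hfm, hf, hfv, hfM, hfV⟩ := hS v hv
  refine ⟨_, Set.mem_image_of_mem _ (x := fun p => ⨍ y in Metric.ball p.1 δ, f y) ?_, ?_⟩
  · refine fun p _ => abs_le.1 ?_
    have hp : volume.real (Metric.ball p.1 δ) = c :=
      congrArg ENNReal.toReal (Measure.addHaar_ball_center _ _ _)
    change |⨍ y in Metric.ball p.1 δ, f y| ≤ _
    rw [setAverage_eq, hp, smul_eq_mul, abs_mul, abs_of_pos (inv_pos.2 hc)]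
    gcongr
    exact abs_integral_le_integral_abs.trans
      ((setIntegral_le_integral hf.abs (ae_of_all _ fun _ => abs_nonneg _)).trans hfM)
  · rw [← ENNReal.ofReal_lt_ofReal_iff hε, ← edist_dist, Lp.edist_def,
      eLpNorm_one_eq_lintegral_enorm]
    have h1 := lintegral_sub_average_ball_le hfm hf hΩ hδ (η := C * (2 * δ) * M) (fun h hh =>
      integral_abs_translate_sub_le hf hfV (by positivity) ((hνC h).trans (by gcongr))) hπ
    refine lt_of_le_of_lt (le_of_eq_of_le (lintegral_congr_ae ?_) h1) ?_
    · filter_upwards [hfv, coeFn_simpleFuncComp (Ω := Ω) π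
        (fun p => ⨍ y in Metric.ball p δ, f y)] with x hx hx2
      rw [Pi.sub_apply, hx2, hx]
    · have h2 : (2 : ℝ≥0∞) ^ N = ENNReal.ofReal ((2 : ℝ) ^ N) := by
        rw [ENNReal.ofReal_pow zero_le_two]; simp
      rw [h2, ← ENNReal.ofReal_mul (by positivity), ENNReal.ofReal_lt_ofReal_iff hε]
      have : 2 ^ N * (C * (2 * δ) * M) = ε / 2 := by
        simp only [δ]; field_simp
      linarith

variable {ν : Seminorm ℝ (RN N)} {Ω : Set (RN N)}

lemma totallyBounded_bvNorm_le (hΩ : MeasurableSet Ω) (hb : Bornology.IsBounded Ω)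
    (hext : IsBVExtensionDomain ν Ω) (M : ℝ≥0) :
    TotallyBounded {v : L1 Ω | v ∈ BV ν Ω ∧ bvNorm ν v ≤ M} := by
  obtain ⟨T, ⟨C, hC⟩, hT⟩ := hext
  -- The `+ 1` only makes the bound positive.
  refine totallyBounded_of_extension (ν := ν) hΩ hb (M := C * M + 1) (by positivity) ?_
  rintro v ⟨hv, hvM⟩
  set f := (T ⟨v, hv⟩).1
  have hfn : bvNorm ν f ≤ ENNReal.ofReal (C * M + 1) := by
    refine (hC ⟨v, hv⟩).trans ((mul_le_mul_right hvM _).trans ?_)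
    rw [← ENNReal.coe_mul, ← ENNReal.ofReal_coe_nnreal, NNReal.coe_mul]
    exact ENNReal.ofReal_le_ofReal (by linarith)
  have hf : Integrable (f : RN N → ℝ) := by
    simpa only [Measure.restrict_univ] using L1.integrable_coeFn f
  refine ⟨f, (Lp.stronglyMeasurable f).measurable, hf, hT ⟨v, hv⟩, ?_, fun φ hφ => ?_⟩
  · have h1 : ∫ x, |f x| = ‖f‖ := by
      rw [L1.norm_eq_integral_norm, setIntegral_univ]
      rfl
    rw [h1, ← ENNReal.ofReal_le_ofReal_iff (by positivity), ofReal_norm]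
    exact le_self_add.trans hfn
  · have h1 := (le_variation hφ f).trans (le_add_self.trans hfn)
    rw [setIntegral_univ] at h1
    exact (ENNReal.ofReal_le_ofReal_iff (by positivity)).1 h1

/-! ### Stability of the variation and of the uniform constraint under `L¹` limits -/

/-- The variation is a supremum of `L¹`-continuous functionals, since each `divergence φ` is
bounded. -/
lemma variation_le_of_tendsto {v : ℕ → L1 Ω} {v₀ : L1 Ω} (hv : Tendsto v atTop (𝓝 v₀))
    {b : ℝ≥0∞} (hb : ∀ n, variation ν (v n) ≤ b) : variation ν v₀ ≤ b := by
  refine iSup₂_le fun φ hφ => ?_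
  have hc := continuous_divergence hφ.1
  have hs : HasCompactSupport (divergence φ) := by
    refine (hφ.2.1.fderiv (𝕜 := ℝ)).mono fun x hx h0 => hx ?_
    simp [divergence, h0]
  obtain ⟨C, hC⟩ := hc.bounded_above_of_compact_support hs
  have hlim : Tendsto (fun n => ∫ x in Ω, v n x * divergence φ x) atTop
      (𝓝 (∫ x in Ω, v₀ x * divergence φ x)) := by
    rw [tendsto_iff_norm_sub_tendsto_zero]
    have h0 : Tendsto (fun n => ‖v n - v₀‖ * C) atTop (𝓝 0) := by
      simpa using (tendsto_iff_norm_sub_tendsto_zero.1 hv).mul_const C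
    refine squeeze_zero (fun _ => norm_nonneg _) (fun n => ?_) h0
    rw [← integral_sub (integrable_mul_divergence hφ _) (integrable_mul_divergence hφ _),
      L1.norm_eq_integral_norm, ← integral_mul_const]
    refine norm_integral_le_of_norm_le ((L1.integrable_coeFn _).norm.mul_const C) ?_
    filter_upwards [Lp.coeFn_sub (v n) v₀] with x hx
    rw [hx, Pi.sub_apply, ← sub_mul, norm_mul]
    gcongr
    exact hC x
  exact le_of_tendsto' (ENNReal.tendsto_ofReal hlim) fun n => (le_variation hφ _).trans (hb n)

/-- A subsequence converges almost everywhere, and the pointwise bound passes to the limit. -/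
lemma eLpNorm_top_sub_le_of_tendsto {u v : ℕ → L1 Ω} {u₀ v₀ : L1 Ω}
    (hu : Tendsto u atTop (𝓝 u₀)) (hv : Tendsto v atTop (𝓝 v₀)) {ε : ℝ≥0∞}
    (h : ∀ n, eLpNorm (fun x => u n x - v n x) ∞ (volume.restrict Ω) ≤ ε) :
    eLpNorm (fun x => u₀ x - v₀ x) ∞ (volume.restrict Ω) ≤ ε := by
  obtain ⟨k, -, hk⟩ := (tendstoInMeasure_of_tendsto_Lp (hu.sub hv)).exists_seq_tendsto_ae
  rw [eLpNorm_exponent_top]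
  refine eLpNormEssSup_le_of_ae_enorm_bound ?_
  have h1 : ∀ᵐ x ∂(volume.restrict Ω), ∀ n, ‖u n x - v n x‖ₑ ≤ ε := ae_all_iff.2 fun n => by
    have h2 := h n
    rw [eLpNorm_exponent_top] at h2
    exact (enorm_ae_le_eLpNormEssSup (fun x => u n x - v n x) _).mono fun x hx => hx.trans h2
  filter_upwards [hk, h1, ae_all_iff.2 fun n => Lp.coeFn_sub (u n) (v n), Lp.coeFn_sub u₀ v₀]
    with x hx hx1 hx2 hx3
  rw [hx3] at hx
  refine le_of_tendsto' hx.enorm fun n => ?_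
  rw [hx2]
  exact hx1 _

lemma edist_le_of_mem_approximants {ε : ℝ} {u v : L1 Ω} (hv : v ∈ approximants ν ∞ ε u) :
    edist u v ≤ ENNReal.ofReal ε * volume Ω := by
  rw [Lp.edist_def]
  refine (eLpNorm_le_eLpNorm_mul_rpow_measure_univ (q := ∞) le_top
    ((Lp.aestronglyMeasurable u).sub (Lp.aestronglyMeasurable v))).trans ?_
  rw [Measure.restrict_apply_univ, ENNReal.toReal_one, ENNReal.toReal_top, one_div_one,
    div_zero, sub_zero, ENNReal.rpow_one]
  exact mul_le_mul_left hv.2 _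

lemma enorm_le_of_mem_approximants {ε : ℝ} {u v : L1 Ω} (hv : v ∈ approximants ν ∞ ε u) :
    ‖v‖ₑ ≤ ‖u‖ₑ + ENNReal.ofReal ε * volume Ω := by
  have h1 := edist_triangle (0 : L1 Ω) u v
  rw [edist_zero_left, edist_zero_left] at h1
  exact h1.trans (add_le_add_right (edist_le_of_mem_approximants hv) _)

lemma bvNorm_le_of_mem_approximants {ε : ℝ} {u v : L1 Ω} (hv : v ∈ approximants ν ∞ ε u)
    {M : ℝ} (hu : ‖u‖ ≤ M) {b : ℝ≥0∞} (hb : variation ν v ≤ b) :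
    bvNorm ν v ≤ ENNReal.ofReal M + ENNReal.ofReal ε * volume Ω + b := by
  refine add_le_add ((enorm_le_of_mem_approximants hv).trans (add_le_add_left ?_ _)) hb
  rw [← ofReal_norm]
  exact ENNReal.ofReal_le_ofReal hu

lemma exists_mem_approximants_of_epsVariation_lt {p : ℝ≥0∞} {ε : ℝ} {u : L1 Ω} {b : ℝ≥0∞}
    (h : epsVariation ν p ε u < b) : ∃ v ∈ approximants ν p ε u, variation ν v < b := by
  simpa only [epsVariation, iInf_lt_iff, exists_prop] using h

/-- Uniform closeness to `u` on a set of finite measure bounds the `L¹` norm of `v`, so bounds on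
`‖u‖` and on the variation of `v` give a BV bound. -/
lemma totallyBounded_of_approximants (hΩ : MeasurableSet Ω) (hb : Bornology.IsBounded Ω)
    (hext : IsBVExtensionDomain ν Ω) {M ε : ℝ} {b : ℝ≥0∞} (hb' : b ≠ ∞) {S : Set (L1 Ω)}
    (hS : ∀ v ∈ S, variation ν v ≤ b ∧ ∃ u : L1 Ω, ‖u‖ ≤ M ∧ v ∈ approximants ν ∞ ε u) :
    TotallyBounded S := by
  have hK : ENNReal.ofReal M + ENNReal.ofReal ε * volume Ω + b ≠ ∞ := by
    have := hb.measure_lt_top (μ := volume)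
    finiteness
  refine (totallyBounded_bvNorm_le hΩ hb hext
    (ENNReal.ofReal M + ENNReal.ofReal ε * volume Ω + b).toNNReal).subset fun v hv => ?_
  obtain ⟨h1, u, hu, h2⟩ := hS v hv
  refine ⟨h2.1, ?_⟩
  rw [ENNReal.coe_toNNReal hK]
  exact bvNorm_le_of_mem_approximants h2 hu h1

lemma exists_tendsto_subseq_of_totallyBounded {X : Type*} [PseudoMetricSpace X] [CompleteSpace X]
    {v : ℕ → X} (hv : TotallyBounded (Set.range v)) :
    ∃ (x : X) (k : ℕ → ℕ), StrictMono k ∧ Tendsto (v ∘ k) atTop (𝓝 x) := by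
  obtain ⟨x, -, k, hk, h⟩ := (hv.closure.isCompact_of_isClosed
    isClosed_closure).tendsto_subseq fun n => subset_closure (Set.mem_range_self n)
  exact ⟨x, k, hk, h⟩

/-! ### Semicontinuity and compactness for the `(ε, ∞)`-variation -/

lemma epsVariation_le_liminf (hΩ : MeasurableSet Ω) (hb : Bornology.IsBounded Ω)
    (hext : IsBVExtensionDomain ν Ω) {u : ℕ → L1 Ω} {u₀ : L1 Ω}
    (hu : Tendsto u atTop (𝓝 u₀)) (ε : ℝ) :
    epsVariation ν ∞ ε u₀ ≤ liminf (fun n => epsVariation ν ∞ ε (u n)) atTop := by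
  refine le_of_forall_gt fun b hlt => ?_
  -- The limit `v₀` only inherits the non-strict bound `b'`, so room is kept below `b`; this also
  -- makes `b'` finite.
  obtain ⟨b', hlt', hb'⟩ := exists_between hlt
  obtain ⟨k, hk, hkb⟩ := extraction_of_frequently_atTop
    (frequently_lt_of_liminf_lt (by isBoundedDefault) hlt')
  choose v hv hvb using fun n => exists_mem_approximants_of_epsVariation_lt (hkb n)
  obtain ⟨M, hM⟩ := hu.norm.bddAbove_range
  have htb : TotallyBounded (Set.range v) := by
    refine totallyBounded_of_approximants hΩ hb hext (M := M) (ε := ε) (b := b') hb'.ne_top ?_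
    rintro _ ⟨n, rfl⟩
    exact ⟨(hvb n).le, u (k n), hM ⟨k n, rfl⟩, hv n⟩
  obtain ⟨v₀, j, hj, hvj⟩ := exists_tendsto_subseq_of_totallyBounded htb
  have hv₀ : variation ν v₀ ≤ b' := variation_le_of_tendsto hvj fun n => (hvb (j n)).le
  have hmem : v₀ ∈ approximants ν ∞ ε u₀ :=
    ⟨hv₀.trans_lt (hb'.trans_le le_top),
      eLpNorm_top_sub_le_of_tendsto (hu.comp (hk.comp hj).tendsto_atTop) hvj
        fun n => (hv (j n)).2⟩
  exact (iInf₂_le v₀ hmem).trans_lt (hv₀.trans_lt hb')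

lemma mem_regulated_of_tendsto (hΩ : MeasurableSet Ω) (hb : Bornology.IsBounded Ω)
    (hext : IsBVExtensionDomain ν Ω) {u : ℕ → L1 Ω} {u₀ : L1 Ω}
    (hu : Tendsto u atTop (𝓝 u₀))
    (hub : UniformlyBoundedEpsVariations ν ∞ (Set.range u)) : u₀ ∈ regulated ν ∞ Ω := by
  refine fun ε hε => lt_of_le_of_lt ?_ (hub.2 ε hε)
  refine (epsVariation_le_liminf hΩ hb hext hu ε).trans (liminf_le_of_le (by isBoundedDefault) ?_)
  intro b h
  obtain ⟨n, hn⟩ := h.exists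
  exact hn.trans
    (le_iSup₂ (f := fun w (_ : w ∈ Set.range u) => epsVariation ν ∞ ε w) (u n) ⟨n, rfl⟩)

lemma totallyBounded_of_uniformlyBoundedEpsVariations (hΩ : MeasurableSet Ω)
    (hb : Bornology.IsBounded Ω) (hext : IsBVExtensionDomain ν Ω) {F : Set (L1 Ω)} {M : ℝ}
    (hM : ∀ u ∈ F, ‖u‖ ≤ M) (hF : UniformlyBoundedEpsVariations ν ∞ F) : TotallyBounded F := by
  refine totallyBounded_of_approx fun η hη => ?_
  -- Makes the `L¹` error `ε * volume.real Ω` less than `η`; the `+ 1` covers an `Ω` of measure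
  -- zero.
  set ε : ℝ := η / (2 * (volume.real Ω + 1))
  have hε : 0 < ε := by positivity
  -- The infimum need not be known to be attained: a finite `b` strictly above the supremum provides
  -- an approximant for every `u ∈ F`.
  obtain ⟨b, hFb, hb'⟩ := exists_between (hF.2 ε hε)
  refine ⟨{v | variation ν v ≤ b ∧ ∃ u : L1 Ω, ‖u‖ ≤ M ∧ v ∈ approximants ν ∞ ε u},
    totallyBounded_of_approximants hΩ hb hext hb'.ne fun v hv => hv, fun u hu => ?_⟩
  obtain ⟨v, hv, hvb⟩ := exists_mem_approximants_of_epsVariation_lt (lt_of_le_of_lt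
    (le_iSup₂ (f := fun w (_ : w ∈ F) => epsVariation ν ∞ ε w) u hu) hFb)
  refine ⟨v, ⟨hvb.le, u, hM u hu, hv⟩, ?_⟩
  have h1 := edist_le_of_mem_approximants hv
  rw [← ENNReal.ofReal_toReal hb.measure_lt_top.ne, ← ENNReal.ofReal_mul hε.le, edist_dist,
    ENNReal.ofReal_le_ofReal_iff (by positivity)] at h1
  have h2 : ε * (volume.real Ω + 1) = η / 2 := by simp only [ε]; field_simp
  change dist u v ≤ ε * volume.real Ω at h1
  linarith

end BVReg
end
theorem proposition3p11 {N : ℕ} (hN : 1 ≤ N)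
    (ν : Seminorm ℝ (BVReg.RN N)) (hν : ∀ x, ν x = 0 → x = 0)
    (Ω : Set (BVReg.RN N)) (hΩ_open : IsOpen Ω) (hΩ_bdd : Bornology.IsBounded Ω)
    (hΩ_ext : BVReg.IsBVExtensionDomain ν Ω) :
    -- lower semicontinuity under convergence in `L¹(Ω)`
    (∀ (u : ℕ → BVReg.L1 Ω) (u₀ : BVReg.L1 Ω),
      (∀ n, u n ∈ BVReg.regulated ν ∞ Ω) → Tendsto u atTop (𝓝 u₀) →
        (∀ ε : ℝ, 0 < ε → BVReg.epsVariation ν ∞ ε u₀ ≤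
          liminf (fun n => BVReg.epsVariation ν ∞ ε (u n)) atTop) ∧
        -- the limit is regulated if the variations are uniformly bounded
        (BVReg.UniformlyBoundedEpsVariations ν ∞ (Set.range u) →
          u₀ ∈ BVReg.regulated ν ∞ Ω)) ∧
    -- the resulting form of the compactness theorem, with a regulated limit
    (∀ u : ℕ → BVReg.L1 Ω, (∃ M : ℝ, ∀ n, ‖u n‖ ≤ M) →
      BVReg.UniformlyBoundedEpsVariations ν ∞ (Set.range u) →
        ∃ (k : ℕ → ℕ) (u₀ : BVReg.L1 Ω), StrictMono k ∧
          Tendsto (fun j => u (k j)) atTop (𝓝 u₀) ∧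
          u₀ ∈ BVReg.regulated ν ∞ Ω ∧
          ∀ ε : ℝ, 0 < ε → BVReg.epsVariation ν ∞ ε u₀ ≤
            liminf (fun j => BVReg.epsVariation ν ∞ ε (u (k j))) atTop) := by

  have hΩ := hΩ_open.measurableSet
  refine ⟨fun u u₀ _ hu => ⟨fun ε _ => BVReg.epsVariation_le_liminf hΩ hΩ_bdd hΩ_ext hu ε,
    BVReg.mem_regulated_of_tendsto hΩ hΩ_bdd hΩ_ext hu⟩, ?_⟩
  rintro u ⟨M, hM⟩ hu
  obtain ⟨u₀, k, hk, hlim⟩ := BVReg.exists_tendsto_subseq_of_totallyBounded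
    (BVReg.totallyBounded_of_uniformlyBoundedEpsVariations hΩ hΩ_bdd hΩ_ext
      (Set.forall_mem_range.2 hM) hu)
  have hsub : Set.range (fun j => u (k j)) ⊆ Set.range u := Set.range_comp_subset_range k u
  exact ⟨k, u₀, hk, hlim, BVReg.mem_regulated_of_tendsto hΩ hΩ_bdd hΩ_ext hlim
    ⟨hsub.trans hu.1, fun ε hε => (biSup_mono hsub).trans_lt (hu.2 ε hε)⟩,
    fun ε _ => BVReg.epsVariation_le_liminf hΩ hΩ_bdd hΩ_ext hlim ε⟩
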